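/- A rooted tree is a finite, connected, simply connected oriented graph with a distinguished vertex, the root, without incoming edge (edges point away from the root); rooted trees are taken up to isomorphism. Let $\mathcal{H}_R$ be the Hopf algebra of rooted trees over $\mathbb{Q}$: as an algebra it is the polynomial algebra over $\mathbb{Q}$ in the rooted trees; its counit is the algebra morphism $\varepsilon$ with $\varepsilon(t)=0$ for every rooted tree $t$; its coproduct is the algebra morphism $\Delta:\mathcal{H}_R\to\mathcal{H}_R\otimes\mathcal{H}_R$ with $$\Delta(t)=1\otimes t+t\otimes 1+\sum_{c}P^c(t)\otimes R^c(t)$$ for every rooted tree $t$, where $c$ runs over the admissible cuts of $t$, that is, the nonempty sets of edges of $t$ such that every oriented path contains at most one edge of $c$; after removing the edges in $c$, $R^c(t)$ is the component containing the root and $P^c(t)$ is the product of the other components. A (left) $\mathcal{H}_R$-comodule is a $\mathbb{Q}$-vector space $C$ with a linear map $\Delta_C:C\to\mathcal{H}_R\otimes C$ such that $(\Delta\otimes\mathrm{id})\Delta_C=(\mathrm{id}\otimes\Delta_C)\Delta_C$ and $(\varepsilon\otimes\mathrm{id})\Delta_C=\mathrm{id}$. A subcomodule is a subspace $D\subset C$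 with $\Delta_C(D)\subset\mathcal{H}_R\otimes D$; then $D$ and $C/D$ are comodules for the induced maps. A comodule is trivial if $\Delta_C(x)=1\otimes x$ for all $x\in C$. Proposition. Let $C$ be a finite-dimensional $\mathcal{H}_R$-comodule and $n$ its dimension. Then there are subcomodules $$(0)=C^{(0)}\subset C^{(1)}\subset\dots\subset C^{(n)}=C,\qquad \dim C^{(i)}=i\quad(0\le i\le n),$$ such that for every $0\le i<n$ the quotient comodule $C^{(i+1)}/C^{(i)}$ is trivial. -/

import Mathlib

open scoped TensorProduct

/-! ### Comodules over a coalgebra -/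

/-- A left comodule over `A`: a vector space `C` with a coassociative and counital structure map
`C → A ⊗ C`. The axioms only involve the coproduct and the counit of `A`. -/
class LeftComodule (K A C : Type*) [Field K] [Ring A] [Algebra K A] [CoalgebraStruct K A]
    [AddCommGroup C] [Module K C] where
  /-- the structure map -/
  coact : C →ₗ[K] A ⊗[K] C
  /-- `(Δ ⊗ id) ∘ coact = (id ⊗ coact) ∘ coact` -/
  coassoc : (TensorProduct.assoc K A A C).toLinearMap ∘ₗ
      (CoalgebraStruct.comul (R := K) (A := A)).rTensor C ∘ₗ coact = coact.lTensor A ∘ₗ coact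
  /-- `(ε ⊗ id) ∘ coact = id` -/
  counit_coact : (TensorProduct.lid K C).toLinearMap ∘ₗ
      (CoalgebraStruct.counit (R := K) (A := A)).rTensor C ∘ₗ coact = LinearMap.id

/-- A comodule is trivial if its structure map is `x ↦ 1 ⊗ x`. -/
def LeftComodule.IsTrivial (K A C : Type*) [Field K] [Ring A] [Algebra K A] [CoalgebraStruct K A]
    [AddCommGroup C] [Module K C] [LeftComodule K A C] : Prop :=
  ∀ x : C, LeftComodule.coact (K := K) (A := A) x = (1 : A) ⊗ₜ[K] x

/-- A subcomodule of `C`: a subspace `D` whose image under the structure map lies in `A ⊗ D`,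
viewed inside `A ⊗ C`. -/
structure Subcomodule (K A C : Type*) [Field K] [Ring A] [Algebra K A] [CoalgebraStruct K A]
    [AddCommGroup C] [Module K C] [LeftComodule K A C] where
  /-- the underlying subspace -/
  toSubmodule : Submodule K C
  coact_mem : ∀ x ∈ toSubmodule, LeftComodule.coact (K := K) (A := A) x ∈
    LinearMap.range (toSubmodule.subtype.lTensor A)

namespace Subcomodule

section

variable {K A C : Type*} [Field K] [Ring A] [Algebra K A] [CoalgebraStruct K A]
  [AddCommGroup C] [Module K C] [LeftComodule K A C]

theorem lTensor_subtype_injective {K A C : Type*} [Field K] [Ring A] [Algebra K A]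
    [AddCommGroup C] [Module K C] (D : Submodule K C) :
    Function.Injective (D.subtype.lTensor A) :=
  Module.Flat.lTensor_preserves_injective_linearMap _ D.injective_subtype

theorem lTensor_lTensor_comp_assoc_comp_rTensor {K A V W : Type*} [Field K] [Ring A] [Algebra K A]
    [AddCommGroup V] [Module K V] [AddCommGroup W] [Module K W]
    (d : A →ₗ[K] A ⊗[K] A) (f : V →ₗ[K] W) :
    (f.lTensor A).lTensor A ∘ₗ (TensorProduct.assoc K A A V).toLinearMap ∘ₗ d.rTensor V =
      (TensorProduct.assoc K A A W).toLinearMap ∘ₗ d.rTensor W ∘ₗ f.lTensor A := by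
  have h : (f.lTensor A).lTensor A ∘ₗ (TensorProduct.assoc K A A V).toLinearMap =
      (TensorProduct.assoc K A A W).toLinearMap ∘ₗ f.lTensor (A ⊗[K] A) := by
    ext; simp
  rw [← LinearMap.comp_assoc, h, LinearMap.comp_assoc, LinearMap.lTensor_comp_rTensor,
    LinearMap.rTensor_comp_lTensor]

theorem comp_lid_comp_rTensor {K A V W : Type*} [Field K] [Ring A] [Algebra K A]
    [AddCommGroup V] [Module K V] [AddCommGroup W] [Module K W]
    (d : A →ₗ[K] K) (f : V →ₗ[K] W) :
    f ∘ₗ (TensorProduct.lid K V).toLinearMap ∘ₗ d.rTensor V =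
      (TensorProduct.lid K W).toLinearMap ∘ₗ d.rTensor W ∘ₗ f.lTensor A := by
  ext; simp

/-- The structure map of a subcomodule: the restriction of the structure map of `C`. -/
noncomputable def restrictCoact (D : Subcomodule K A C) :
    D.toSubmodule →ₗ[K] A ⊗[K] D.toSubmodule :=
  (LinearEquiv.ofInjective _ (lTensor_subtype_injective (A := A) D.toSubmodule)).symm.toLinearMap ∘ₗ
    LinearMap.codRestrict (LinearMap.range (D.toSubmodule.subtype.lTensor A))
      (LeftComodule.coact (K := K) (A := A) ∘ₗ D.toSubmodule.subtype)
      (fun x => D.coact_mem x x.2)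

theorem lTensor_comp_restrictCoact (D : Subcomodule K A C) :
    D.toSubmodule.subtype.lTensor A ∘ₗ D.restrictCoact =
      LeftComodule.coact (K := K) (A := A) ∘ₗ D.toSubmodule.subtype := by
  ext x
  have h := LinearEquiv.apply_symm_apply
    (LinearEquiv.ofInjective _ (lTensor_subtype_injective (A := A) D.toSubmodule))
    (LinearMap.codRestrict (LinearMap.range (D.toSubmodule.subtype.lTensor A))
      (LeftComodule.coact (K := K) (A := A) ∘ₗ D.toSubmodule.subtype)
      (fun x => D.coact_mem x x.2) x)
  exact congrArg Subtype.val h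

/-- A subcomodule is a comodule for the restricted structure map. -/
noncomputable instance instLeftComodule (D : Subcomodule K A C) :
    LeftComodule K A D.toSubmodule where
  coact := D.restrictCoact
  coassoc := by
    have hinj : Function.Injective ((D.toSubmodule.subtype.lTensor A).lTensor A) :=
      Module.Flat.lTensor_preserves_injective_linearMap _
        (lTensor_subtype_injective (A := A) D.toSubmodule)
    refine LinearMap.cancel_left hinj |>.1 ?_
    have h1 : ((D.toSubmodule.subtype.lTensor A).lTensor A) ∘ₗ
        (TensorProduct.assoc K A A D.toSubmodule).toLinearMap ∘ₗ
          (CoalgebraStruct.comul (R := K) (A := A)).rTensor D.toSubmodule =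
        (TensorProduct.assoc K A A C).toLinearMap ∘ₗ
          (CoalgebraStruct.comul (R := K) (A := A)).rTensor C ∘ₗ
            D.toSubmodule.subtype.lTensor A :=
      lTensor_lTensor_comp_assoc_comp_rTensor _ _
    calc _ = (((D.toSubmodule.subtype.lTensor A).lTensor A) ∘ₗ
        (TensorProduct.assoc K A A D.toSubmodule).toLinearMap ∘ₗ
          (CoalgebraStruct.comul (R := K) (A := A)).rTensor D.toSubmodule) ∘ₗ
            D.restrictCoact := rfl
      _ = ((TensorProduct.assoc K A A C).toLinearMap ∘ₗ
          (CoalgebraStruct.comul (R := K) (A := A)).rTensor C) ∘ₗ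
            (D.toSubmodule.subtype.lTensor A ∘ₗ D.restrictCoact) := by rw [h1]; rfl
      _ = ((TensorProduct.assoc K A A C).toLinearMap ∘ₗ
          (CoalgebraStruct.comul (R := K) (A := A)).rTensor C ∘ₗ
            LeftComodule.coact (K := K) (A := A)) ∘ₗ D.toSubmodule.subtype := by
          rw [lTensor_comp_restrictCoact]; rfl
      _ = (LeftComodule.coact (K := K) (A := A) (C := C)).lTensor A ∘ₗ
            (LeftComodule.coact (K := K) (A := A) ∘ₗ D.toSubmodule.subtype) := by
          rw [LeftComodule.coassoc]; rfl
      _ = ((LeftComodule.coact (K := K) (A := A) (C := C)).lTensor A ∘ₗ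
            D.toSubmodule.subtype.lTensor A) ∘ₗ D.restrictCoact := by
          rw [← lTensor_comp_restrictCoact]; rfl
      _ = _ := by
          rw [← LinearMap.lTensor_comp, ← lTensor_comp_restrictCoact, LinearMap.lTensor_comp]; rfl
  counit_coact := by
    refine LinearMap.cancel_left D.toSubmodule.injective_subtype |>.1 ?_
    calc _ = (D.toSubmodule.subtype ∘ₗ (TensorProduct.lid K D.toSubmodule).toLinearMap ∘ₗ
          (CoalgebraStruct.counit (R := K) (A := A)).rTensor D.toSubmodule) ∘ₗ
            D.restrictCoact := rfl
      _ = ((TensorProduct.lid K C).toLinearMap ∘ₗ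
          (CoalgebraStruct.counit (R := K) (A := A)).rTensor C) ∘ₗ
            (D.toSubmodule.subtype.lTensor A ∘ₗ D.restrictCoact) := by
          rw [comp_lid_comp_rTensor]; rfl
      _ = ((TensorProduct.lid K C).toLinearMap ∘ₗ
          (CoalgebraStruct.counit (R := K) (A := A)).rTensor C ∘ₗ
            LeftComodule.coact (K := K) (A := A)) ∘ₗ D.toSubmodule.subtype := by
          rw [lTensor_comp_restrictCoact]; rfl
      _ = _ := by rw [LeftComodule.counit_coact]; rfl

/-- The structure map `C ⧸ D → A ⊗ (C ⧸ D)` induced by that of `C`. -/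
noncomputable def quotientCoact (D : Subcomodule K A C) :
    (C ⧸ D.toSubmodule) →ₗ[K] A ⊗[K] (C ⧸ D.toSubmodule) :=
  D.toSubmodule.liftQ (D.toSubmodule.mkQ.lTensor A ∘ₗ LeftComodule.coact (K := K) (A := A)) (by
    intro x hx
    obtain ⟨y, hy⟩ := D.coact_mem x hx
    rw [LinearMap.mem_ker, LinearMap.comp_apply, ← hy, ← LinearMap.comp_apply,
      ← LinearMap.lTensor_comp]
    have : D.toSubmodule.mkQ ∘ₗ D.toSubmodule.subtype = 0 := by ext; simp
    simp [this])

theorem quotientCoact_comp_mkQ (D : Subcomodule K A C) :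
    D.quotientCoact ∘ₗ D.toSubmodule.mkQ =
      D.toSubmodule.mkQ.lTensor A ∘ₗ LeftComodule.coact (K := K) (A := A) :=
  Submodule.liftQ_mkQ _ _ _

/-- The quotient of a comodule by a subcomodule is a comodule. -/
noncomputable instance instLeftComoduleQuotient (D : Subcomodule K A C) :
    LeftComodule K A (C ⧸ D.toSubmodule) where
  coact := D.quotientCoact
  coassoc := by
    refine LinearMap.cancel_right D.toSubmodule.mkQ_surjective |>.1 ?_
    calc _ = ((TensorProduct.assoc K A A (C ⧸ D.toSubmodule)).toLinearMap ∘ₗ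
          (CoalgebraStruct.comul (R := K) (A := A)).rTensor (C ⧸ D.toSubmodule)) ∘ₗ
            (D.quotientCoact ∘ₗ D.toSubmodule.mkQ) := rfl
      _ = ((TensorProduct.assoc K A A (C ⧸ D.toSubmodule)).toLinearMap ∘ₗ
          (CoalgebraStruct.comul (R := K) (A := A)).rTensor (C ⧸ D.toSubmodule) ∘ₗ
            D.toSubmodule.mkQ.lTensor A) ∘ₗ LeftComodule.coact (K := K) (A := A) := by
          rw [quotientCoact_comp_mkQ]; rfl
      _ = (D.toSubmodule.mkQ.lTensor A).lTensor A ∘ₗ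
          ((TensorProduct.assoc K A A C).toLinearMap ∘ₗ
            (CoalgebraStruct.comul (R := K) (A := A)).rTensor C ∘ₗ
              LeftComodule.coact (K := K) (A := A)) := by
          rw [← lTensor_lTensor_comp_assoc_comp_rTensor]; rfl
      _ = ((D.toSubmodule.mkQ.lTensor A).lTensor A ∘ₗ
            (LeftComodule.coact (K := K) (A := A) (C := C)).lTensor A) ∘ₗ
              LeftComodule.coact (K := K) (A := A) := by
          rw [LeftComodule.coassoc]; rfl
      _ = D.quotientCoact.lTensor A ∘ₗ
            (D.toSubmodule.mkQ.lTensor A ∘ₗ LeftComodule.coact (K := K) (A := A)) := by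
          rw [← LinearMap.lTensor_comp, ← quotientCoact_comp_mkQ, LinearMap.lTensor_comp]; rfl
      _ = _ := by rw [← quotientCoact_comp_mkQ]; rfl
  counit_coact := by
    refine LinearMap.cancel_right D.toSubmodule.mkQ_surjective |>.1 ?_
    calc _ = ((TensorProduct.lid K (C ⧸ D.toSubmodule)).toLinearMap ∘ₗ
          (CoalgebraStruct.counit (R := K) (A := A)).rTensor (C ⧸ D.toSubmodule)) ∘ₗ
            (D.quotientCoact ∘ₗ D.toSubmodule.mkQ) := rfl
      _ = ((TensorProduct.lid K (C ⧸ D.toSubmodule)).toLinearMap ∘ₗ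
          (CoalgebraStruct.counit (R := K) (A := A)).rTensor (C ⧸ D.toSubmodule) ∘ₗ
            D.toSubmodule.mkQ.lTensor A) ∘ₗ LeftComodule.coact (K := K) (A := A) := by
          rw [quotientCoact_comp_mkQ]; rfl
      _ = D.toSubmodule.mkQ ∘ₗ
          ((TensorProduct.lid K C).toLinearMap ∘ₗ
            (CoalgebraStruct.counit (R := K) (A := A)).rTensor C ∘ₗ
              LeftComodule.coact (K := K) (A := A)) := by
          rw [← comp_lid_comp_rTensor]; rfl
      _ = _ := by rw [LeftComodule.counit_coact]; rfl

/-- For subcomodules `D ≤ E` of `C`, the subcomodule `D` of `E`. -/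
def inside (D E : Subcomodule K A C) (h : D.toSubmodule ≤ E.toSubmodule) :
    Subcomodule K A E.toSubmodule where
  toSubmodule := D.toSubmodule.submoduleOf E.toSubmodule
  coact_mem := by
    intro x hx
    obtain ⟨y, hy⟩ := D.coact_mem x hx
    let j : D.toSubmodule →ₗ[K] D.toSubmodule.submoduleOf E.toSubmodule :=
      LinearMap.codRestrict _ (Submodule.inclusion h) fun z => z.2
    refine ⟨j.lTensor A y, lTensor_subtype_injective (A := A) E.toSubmodule ?_⟩
    have h1 : E.toSubmodule.subtype ∘ₗ (D.toSubmodule.submoduleOf E.toSubmodule).subtype ∘ₗ j =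
        D.toSubmodule.subtype := rfl
    have h2 := LinearMap.congr_fun E.lTensor_comp_restrictCoact x
    simp only [LinearMap.comp_apply] at h2
    refine Eq.trans ?_ h2.symm
    rw [← LinearMap.comp_apply, ← LinearMap.comp_apply, ← LinearMap.lTensor_comp,
      ← LinearMap.lTensor_comp, LinearMap.comp_assoc, h1, hy]
    rfl

end

end Subcomodule

/-! ### The Hopf algebra of rooted trees -/

namespace ConnesKreimer

/-- A finite rooted tree. The vertices are partially ordered with the root `⊥` as least element;
the edges are the pairs `(Order.pred v, v)` for the vertices `v ≠ ⊥`. -/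
structure FinTree where
  /-- the underlying rooted tree -/
  tree : RootedTree.{0}
  finite : Finite tree

attribute [instance] FinTree.finite

/-- Two finite rooted trees are identified when they are isomorphic. -/
instance FinTree.setoid : Setoid FinTree where
  r s t := Nonempty (s.tree ≃o t.tree)
  iseqv :=
    { refl := fun _ => ⟨OrderIso.refl _⟩
      symm := fun ⟨e⟩ => ⟨e.symm⟩
      trans := fun ⟨e⟩ ⟨f⟩ => ⟨e.trans f⟩ }

/-- Isomorphism classes of finite rooted trees. -/
def TreeClass : Type 1 := Quotient FinTree.setoid

/-- The algebra of polynomials over `ℚ` in (isomorphism classes of) rooted trees. -/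
def HR : Type 1 := MvPolynomial TreeClass ℚ

noncomputable instance : CommRing HR := inferInstanceAs (CommRing (MvPolynomial TreeClass ℚ))

noncomputable instance : Algebra ℚ HR := inferInstanceAs (Algebra ℚ (MvPolynomial TreeClass ℚ))

/-- The generator of `HR` given by a finite rooted tree. -/
noncomputable def FinTree.gen (t : FinTree) : HR :=
  (MvPolynomial.X (Quotient.mk FinTree.setoid t) : MvPolynomial TreeClass ℚ)

/-- An admissible cut of `t`: a nonempty set of edges such that every path going away from the
root contains at most one of them. The edge `(Order.pred v, v)` is recorded by its endpoint `v`. -/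
@[ext]
structure AdmissibleCut (t : FinTree) where
  /-- the endpoints (away from the root) of the edges that are cut -/
  cut : Finset t.tree
  nonempty : cut.Nonempty
  bot_notMem : ⊥ ∉ cut
  antichain : IsAntichain (· ≤ ·) (cut : Set t.tree)

noncomputable instance (t : FinTree) : Fintype (AdmissibleCut t) :=
  haveI : Finite (AdmissibleCut t) :=
    Finite.of_injective AdmissibleCut.cut fun _ _ h => AdmissibleCut.ext h
  Fintype.ofFinite _

/-- The tree of all vertices of `t` lying above `v`; it is the component, not containing the root,
that is cut off at the edge `(Order.pred v, v)`. -/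
noncomputable def FinTree.above (t : FinTree) (v : t.tree) : FinTree where
  tree := (t.tree.subtree v).coeTree
  finite := inferInstanceAs (Finite (Set.Ici v))

/-- The vertices of the component containing the root after the cut `c`. -/
def AdmissibleCut.trunkSet {t : FinTree} (c : AdmissibleCut t) : Set t.tree :=
  {x | ∀ v ∈ c.cut, ¬ v ≤ x}

instance AdmissibleCut.trunkSet_ordConnected {t : FinTree} (c : AdmissibleCut t) :
    c.trunkSet.OrdConnected :=
  ⟨fun _ _ _ hy _ hz v hv hvz => hy v hv (hvz.trans hz.2)⟩

/-- The component `R^c(t)` containing the root after the cut `c`. -/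
noncomputable def AdmissibleCut.trunk {t : FinTree} (c : AdmissibleCut t) : FinTree where
  tree :=
    { α := c.trunkSet
      semilatticeInf := Subtype.semilatticeInf fun {_ _} hx _ w hw h =>
        hx w hw (h.trans inf_le_left)
      orderBot := Subtype.orderBot fun _ hv h => c.bot_notMem (le_bot_iff.1 h ▸ hv)
      predOrder := inferInstance
      isPredArchimedean := inferInstance }
  finite := inferInstanceAs (Finite c.trunkSet)

/-- `P^c(t)`: the product of the components not containing the root after the cut `c`. -/
noncomputable def AdmissibleCut.pruned {t : FinTree} (c : AdmissibleCut t) : HR :=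
  ∏ v ∈ c.cut, (t.above v).gen

/-- `1 ⊗ t + t ⊗ 1 + ∑ P^c(t) ⊗ R^c(t)`, the sum being over the admissible cuts `c` of `t`. -/
noncomputable def FinTree.coproduct (t : FinTree) : HR ⊗[ℚ] HR :=
  1 ⊗ₜ t.gen + t.gen ⊗ₜ 1 + ∑ c : AdmissibleCut t, c.pruned ⊗ₜ c.trunk.gen

theorem FinTree.gen_eq {s t : FinTree} (e : s.tree ≃o t.tree) : s.gen = t.gen :=
  congrArg (fun q : TreeClass => (MvPolynomial.X q : MvPolynomial TreeClass ℚ))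
    (Quotient.sound ⟨e⟩)

/-- Transport of an admissible cut along an isomorphism. -/
def AdmissibleCut.map {s t : FinTree} (e : s.tree ≃o t.tree) (c : AdmissibleCut s) :
    AdmissibleCut t where
  cut := c.cut.map e.toEquiv.toEmbedding
  nonempty := c.nonempty.map
  bot_notMem := by
    intro h
    obtain ⟨v, hv, hve⟩ := Finset.mem_map.1 h
    exact c.bot_notMem ((map_eq_bot_iff e).1 hve ▸ hv)
  antichain := by
    intro a ha b hb hab hle
    obtain ⟨v, hv, rfl⟩ := Finset.mem_map.1 (Finset.mem_coe.1 ha)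
    obtain ⟨w, hw, rfl⟩ := Finset.mem_map.1 (Finset.mem_coe.1 hb)
    exact c.antichain hv hw (fun h => hab (h ▸ rfl)) (e.le_iff_le.1 hle)

theorem AdmissibleCut.pruned_map {s t : FinTree} (e : s.tree ≃o t.tree) (c : AdmissibleCut s) :
    (c.map e).pruned = c.pruned := by
  refine (Finset.prod_map _ _ _).trans (Finset.prod_congr rfl fun v _ => ?_)
  exact (FinTree.gen_eq (s := s.above v) (t := t.above (e v))
    { toFun := fun x => ⟨e x.1, e.monotone x.2⟩
      invFun := fun y => ⟨e.symm y.1, (e.le_symm_apply).2 y.2⟩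
      left_inv := fun x => Subtype.ext (e.symm_apply_apply x.1)
      right_inv := fun y => Subtype.ext (e.apply_symm_apply y.1)
      map_rel_iff' := e.le_iff_le }).symm

theorem AdmissibleCut.gen_trunk_map {s t : FinTree} (e : s.tree ≃o t.tree) (c : AdmissibleCut s) :
    (c.map e).trunk.gen = c.trunk.gen :=
  (FinTree.gen_eq (s := c.trunk) (t := (c.map e).trunk)
    { toFun := fun x => ⟨e x.1, fun w hw hwx => by
        obtain ⟨v, hv, rfl⟩ := Finset.mem_map.1 hw
        exact x.2 v hv (e.le_iff_le.1 hwx)⟩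
      invFun := fun y => ⟨e.symm y.1, fun v hv hvy =>
        y.2 (e v) (Finset.mem_map.2 ⟨v, hv, rfl⟩) ((e.le_symm_apply).1 hvy)⟩
      left_inv := fun x => Subtype.ext (e.symm_apply_apply x.1)
      right_inv := fun y => Subtype.ext (e.apply_symm_apply y.1)
      map_rel_iff' := e.le_iff_le }).symm

theorem FinTree.coproduct_eq {s t : FinTree} (e : s.tree ≃o t.tree) :
    s.coproduct = t.coproduct := by
  let E : AdmissibleCut s ≃ AdmissibleCut t :=
    { toFun := AdmissibleCut.map e
      invFun := AdmissibleCut.map e.symm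
      left_inv := fun c => AdmissibleCut.ext (by
        ext v; simp [AdmissibleCut.map])
      right_inv := fun c => AdmissibleCut.ext (by
        ext v; simp [AdmissibleCut.map]) }
  unfold FinTree.coproduct
  rw [FinTree.gen_eq e]
  congr 1
  refine Fintype.sum_equiv E _ _ fun c => ?_
  rw [show E c = c.map e from rfl, AdmissibleCut.pruned_map, AdmissibleCut.gen_trunk_map]

/-- The coproduct: the morphism of algebras with
`Δ(t) = 1 ⊗ t + t ⊗ 1 + ∑ P^c(t) ⊗ R^c(t)` for every rooted tree `t`. -/
noncomputable def comulHom : HR →ₐ[ℚ] HR ⊗[ℚ] HR :=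
  (MvPolynomial.aeval fun q : TreeClass =>
    Quotient.lift FinTree.coproduct
      (fun _ _ h => Nonempty.elim h fun e => FinTree.coproduct_eq e) q :
    MvPolynomial TreeClass ℚ →ₐ[ℚ] HR ⊗[ℚ] HR)

/-- The counit: the morphism of algebras with `ε(t) = 0` for every rooted tree `t`. -/
noncomputable def counitHom : HR →ₐ[ℚ] ℚ :=
  (MvPolynomial.aeval fun _ : TreeClass => (0 : ℚ) : MvPolynomial TreeClass ℚ →ₐ[ℚ] ℚ)

noncomputable instance : CoalgebraStruct ℚ HR where
  comul := comulHom.toLinearMap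
  counit := counitHom.toLinearMap

theorem comulHom_gen (t : FinTree) : comulHom t.gen = t.coproduct :=
  MvPolynomial.aeval_X _ _

theorem counitHom_gen (t : FinTree) : counitHom t.gen = 0 :=
  MvPolynomial.aeval_X _ _

end ConnesKreimer

/-! ### Linear projections onto the components of a grading, and coinvariants -/

section Coinvariants

variable {K A C : Type*} [Field K] [Ring A] [Algebra K A] [AddCommGroup C] [Module K C]

/-! The Hopf algebra of rooted trees is graded by the number of vertices and connected: degree 0
consists of the scalars. Over such an algebra every nonzero finite-dimensional comodule `C` contains
a nonzero coinvariant vector, that is, some `y` with `coact y = 1 ⊗ y`. Indeed, let `d k` be the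
degree `k` part of `coact`. By finite dimension there is a largest `k` with `d k ≠ 0`; choose `x`
with `d k x ≠ 0` and a functional `f` on the algebra such that `y = (f ⊗ id) (d k x)` is nonzero.
Coassociativity expresses `(id ⊗ d j) (d k x)` through `d (k + j) x`, which vanishes for `j > 0`.
Hence `d j y = 0` for all `j > 0`, and the counit axiom turns the remaining degree 0 part into `1 ⊗
y` (`exists_ne_zero_coact_eq_one_tmul`).

Applied to `C ⧸ D`, this enlarges a proper subcomodule `D` by one dimension with trivial quotient
(`exists_finrank_eq_succ`); iterating from zero gives the flag (`exists_flag`).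

That the coproduct respects the grading (`map_component_comul_component`) is seen through the
endomorphism `t ↦ 2 ^ |t| • t`: it commutes with the coproduct, and its eigenvalues `2 ^ m` separate
the degrees. -/

/-- The family `p` plays the role of the projections of a grading; all that is asked of it here is
that its partial sums eventually fix each element. Asking this for all `M ≥ N` lets the bounds of
two summands be merged. -/
theorem exists_sum_rTensor_eq_of_exists_sum_eq {p : ℕ → A →ₗ[K] A}
    (hp : ∀ a, ∃ N, ∀ M ≥ N, ∑ k ∈ Finset.range M, p k a = a) (z : A ⊗[K] C) :
    ∃ N, ∀ M ≥ N, ∑ k ∈ Finset.range M, (p k).rTensor C z = z := by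
  induction z using TensorProduct.induction_on with
  | zero => exact ⟨0, by simp⟩
  | tmul a c =>
    obtain ⟨N, hN⟩ := hp a
    refine ⟨N, fun M hM => ?_⟩
    simp only [LinearMap.rTensor_tmul]
    rw [← TensorProduct.sum_tmul, hN M hM]
  | add x y hx hy =>
    obtain ⟨N, hN⟩ := hx
    obtain ⟨N', hN'⟩ := hy
    refine ⟨max N N', fun M hM => ?_⟩
    simp only [map_add, Finset.sum_add_distrib]
    rw [hN M (le_trans (le_max_left _ _) hM), hN' M (le_trans (le_max_right _ _) hM)]

/-- Two consecutive partial sums that both equal `z` differ by the `k`-th term. -/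
theorem exists_rTensor_eq_zero_of_exists_sum_eq {p : ℕ → A →ₗ[K] A}
    (hp : ∀ a, ∃ N, ∀ M ≥ N, ∑ k ∈ Finset.range M, p k a = a) (z : A ⊗[K] C) :
    ∃ N, ∀ k ≥ N, (p k).rTensor C z = 0 := by
  obtain ⟨N, hN⟩ := exists_sum_rTensor_eq_of_exists_sum_eq hp z
  refine ⟨N, fun k hk => ?_⟩
  have h := hN (k + 1) (by omega)
  rwa [Finset.sum_range_succ, hN k hk, add_eq_left] at h

theorem rTensor_zero_eq_self_of_forall_succ {p : ℕ → A →ₗ[K] A}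
    (hp : ∀ a, ∃ N, ∀ M ≥ N, ∑ k ∈ Finset.range M, p k a = a) {z : A ⊗[K] C}
    (hz : ∀ k, (p (k + 1)).rTensor C z = 0) : (p 0).rTensor C z = z := by
  obtain ⟨N, hN⟩ := exists_sum_rTensor_eq_of_exists_sum_eq hp z
  have h := hN (N + 1) (by omega)
  rwa [Finset.sum_range_succ', Finset.sum_eq_zero fun k _ => hz k, zero_add] at h

/-- A tensor is determined by its coordinates along a basis of `A`, so some coordinate functional
detects `z`. -/
theorem exists_lid_rTensor_ne_zero {z : A ⊗[K] C} (hz : z ≠ 0) :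
    ∃ f : A →ₗ[K] K, TensorProduct.lid K C (f.rTensor C z) ≠ 0 := by
  classical
  let b := Module.Basis.ofVectorSpace K A
  by_contra! h
  refine hz ((TensorProduct.equivFinsuppOfBasisLeft (N := C) b).injective ?_)
  rw [map_zero]
  ext i
  rw [TensorProduct.equivFinsuppOfBasisLeft_apply, h]
  rfl

variable [CoalgebraStruct K A] [LeftComodule K A C]

open LeftComodule CoalgebraStruct

/-- If the structure map takes values in the degree zero part, then it is trivial. -/
theorem coact_eq_one_tmul_of_rTensor_eq_self {p : A →ₗ[K] A}
    (hp : ∀ a, p a = algebraMap K A (counit (R := K) a)) {x : C}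
    (hx : p.rTensor C (coact (K := K) (A := A) x) = coact (K := K) (A := A) x) :
    coact (K := K) (A := A) x = (1 : A) ⊗ₜ[K] x := by
  -- Since `p` is the counit followed by the unit, `p ⊗ id` factors through `ε ⊗ id`, to which the
  -- counit axiom applies.
  have h : ∀ z : A ⊗[K] C, p.rTensor C z = (1 : A) ⊗ₜ[K]
      TensorProduct.lid K C ((counit (R := K) (A := A)).rTensor C z) := by
    intro z
    induction z using TensorProduct.induction_on with
    | zero => simp
    | tmul a c =>
      simp [hp, Algebra.algebraMap_eq_smul_one, TensorProduct.smul_tmul]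
    | add x y hx hy => simp [hx, hy, TensorProduct.tmul_add]
  rw [← hx, h]
  exact congrArg _ (LinearMap.congr_fun (counit_coact (K := K) (A := A) (C := C)) x)

/-- Compatibility of the structure map with the degrees. -/
theorem lTensor_coact_rTensor_coact_eq_zero {p : ℕ → A →ₗ[K] A}
    (hp : ∀ a, ∃ N, ∀ M ≥ N, ∑ k ∈ Finset.range M, p k a = a)
    (hcomul : ∀ i j m, m ≠ i + j → ∀ a,
      TensorProduct.map (p i) (p j) (comul (R := K) (p m a)) = 0)
    {i j : ℕ} {x : C} (hx : (p (i + j)).rTensor C (coact (K := K) (A := A) x) = 0) :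
    (((p j).rTensor C) ∘ₗ coact (K := K) (A := A)).lTensor A
      ((p i).rTensor C (coact (K := K) (A := A) x)) = 0 := by
  have h1 : (((p j).rTensor C) ∘ₗ coact (K := K) (A := A)).lTensor A ∘ₗ (p i).rTensor C =
      TensorProduct.map (p i) ((p j).rTensor C) ∘ₗ (coact (K := K) (A := A) (C := C)).lTensor A := by
    ext; simp
  have h2 : TensorProduct.map (p i) ((p j).rTensor C) ∘ₗ
      (TensorProduct.assoc K A A C).toLinearMap =
      (TensorProduct.assoc K A A C).toLinearMap ∘ₗ (TensorProduct.map (p i) (p j)).rTensor C := by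
    ext; simp
  have h3 := LinearMap.congr_fun (LeftComodule.coassoc (K := K) (A := A) (C := C)) x
  rw [← LinearMap.comp_apply, h1, LinearMap.comp_apply]
  simp only [LinearMap.comp_apply] at h3
  rw [← h3, ← LinearMap.comp_apply, h2, LinearMap.comp_apply, LinearEquiv.coe_coe,
    LinearEquiv.map_eq_zero_iff, ← LinearMap.comp_apply, ← LinearMap.rTensor_comp]
  -- What remains is `((p i ⊗ p j) ∘ Δ) ⊗ id` on `coact x`. Splitting `coact x` by degree, `hcomul`
  -- kills every degree except `i + j`, and `hx` kills that one.
  obtain ⟨N, hN⟩ := exists_sum_rTensor_eq_of_exists_sum_eq hp (coact (K := K) (A := A) x)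
  rw [← hN N le_rfl, map_sum]
  refine Finset.sum_eq_zero fun m _ => ?_
  by_cases hm : m = i + j
  · rw [hm, hx, map_zero]
  · rw [← LinearMap.comp_apply, ← LinearMap.rTensor_comp]
    have : (TensorProduct.map (p i) (p j) ∘ₗ comul (R := K) (A := A)) ∘ₗ p m = 0 := by
      ext a; exact hcomul i j m hm a
    rw [this]; simp

/-- A nonzero finite-dimensional comodule over a connected graded coalgebra has a nonzero
coinvariant element. -/
theorem exists_ne_zero_coact_eq_one_tmul [FiniteDimensional K C] [Nontrivial C]
    {p : ℕ → A →ₗ[K] A}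
    (hp : ∀ a, ∃ N, ∀ M ≥ N, ∑ k ∈ Finset.range M, p k a = a)
    (hp0 : ∀ a, p 0 a = algebraMap K A (counit (R := K) a))
    (hcomul : ∀ i j m, m ≠ i + j → ∀ a,
      TensorProduct.map (p i) (p j) (comul (R := K) (p m a)) = 0) :
    ∃ y : C, y ≠ 0 ∧ coact (K := K) (A := A) y = (1 : A) ⊗ₜ[K] y := by
  classical
  let d : ℕ → C →ₗ[K] A ⊗[K] C := fun k => (p k).rTensor C ∘ₗ coact
  -- Finite dimension enters here: a bound for each of finitely many basis vectors gives a uniform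
  -- one.
  have hd : ∃ N, ∀ k ≥ N, d k = 0 := by
    let b := Module.finBasis K C
    choose N hN using fun i =>
      exists_rTensor_eq_zero_of_exists_sum_eq hp (coact (K := K) (A := A) (b i))
    refine ⟨Finset.univ.sup N, fun k hk => b.ext fun i => ?_⟩
    exact hN i k ((Finset.le_sup (Finset.mem_univ i)).trans hk)
  by_cases hs : ∀ k, d (k + 1) = 0
  · obtain ⟨y, hy⟩ := exists_ne (0 : C)
    refine ⟨y, hy, coact_eq_one_tmul_of_rTensor_eq_self hp0 ?_⟩
    exact rTensor_zero_eq_self_of_forall_succ hp fun k => LinearMap.congr_fun (hs k) y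
  · push Not at hs
    obtain ⟨k₀, hk₀⟩ := hs
    have hfind : 0 < Nat.find hd := by
      by_contra h
      exact hk₀ (Nat.find_spec hd _ (by omega))
    -- `Nat.find hd` is the first index from which all `d` vanish, so its predecessor `k` is the top
    -- degree occurring in `coact`.
    obtain ⟨k, hk⟩ : ∃ k, Nat.find hd = k + 1 := ⟨_, (Nat.succ_pred_eq_of_pos hfind).symm⟩
    have hgt : ∀ m > k, d m = 0 := fun m hm => Nat.find_spec hd m (by omega)
    have hne : d k ≠ 0 := fun h => Nat.find_min hd (m := k) (by omega) fun m hm =>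
      hm.eq_or_lt.elim (fun e => e ▸ h) (hgt m)
    obtain ⟨x, hx⟩ : ∃ x, d k x ≠ 0 := by
      by_contra! h
      exact hne (LinearMap.ext h)
    obtain ⟨f, hf⟩ := exists_lid_rTensor_ne_zero hx
    refine ⟨_, hf, coact_eq_one_tmul_of_rTensor_eq_self hp0
      (rTensor_zero_eq_self_of_forall_succ hp fun j => ?_)⟩
    -- Contracting the first factor with `f` commutes with applying `d (j + 1)` to the second.
    have h1 : d (j + 1) ∘ₗ (TensorProduct.lid K C).toLinearMap ∘ₗ f.rTensor C =
        (TensorProduct.lid K (A ⊗[K] C)).toLinearMap ∘ₗ f.rTensor (A ⊗[K] C) ∘ₗ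
          (d (j + 1)).lTensor A := by
      ext; simp
    have h2 : (d (j + 1)).lTensor A (d k x) = 0 :=
      lTensor_coact_rTensor_coact_eq_zero hp hcomul
        (LinearMap.congr_fun (hgt (k + (j + 1)) (by omega)) x)
    have h3 := LinearMap.congr_fun h1 (d k x)
    simp only [LinearMap.comp_apply, h2, map_zero] at h3
    exact h3

end Coinvariants

/-! ### Flags of subcomodules -/

namespace Subcomodule

section

variable {K A C : Type*} [Field K] [Ring A] [Algebra K A] [CoalgebraStruct K A]
  [AddCommGroup C] [Module K C] [LeftComodule K A C]

open LeftComodule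

/-- Triviality of `E / D` can be tested inside `A ⊗ C`: the defect `coact x - 1 ⊗ x` lies in `A ⊗
D`, which dies in `A ⊗ (E / D)`. -/
theorem isTrivial_quotient_inside {D E : Subcomodule K A C} (h : D.toSubmodule ≤ E.toSubmodule)
    (hE : ∀ x ∈ E.toSubmodule, coact (K := K) (A := A) x - (1 : A) ⊗ₜ[K] x ∈
      LinearMap.range (D.toSubmodule.subtype.lTensor A)) :
    LeftComodule.IsTrivial K A (E.toSubmodule ⧸ (D.inside E h).toSubmodule) := by
  intro q
  obtain ⟨x, rfl⟩ := Submodule.mkQ_surjective _ q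
  obtain ⟨y, hy⟩ := hE x x.2
  let j : D.toSubmodule →ₗ[K] E.toSubmodule := Submodule.inclusion h
  have h1 : E.toSubmodule.subtype ∘ₗ j = D.toSubmodule.subtype := rfl
  have h2 : E.restrictCoact x - (1 : A) ⊗ₜ[K] x = j.lTensor A y := by
    apply lTensor_subtype_injective (A := A) E.toSubmodule
    rw [map_sub, ← LinearMap.comp_apply, lTensor_comp_restrictCoact, ← LinearMap.comp_apply,
      ← LinearMap.lTensor_comp, h1, hy]
    simp
  have h3 : (D.inside E h).toSubmodule.mkQ ∘ₗ j = 0 := by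
    ext z
    exact (Submodule.Quotient.mk_eq_zero _).2 z.2
  have h4 := LinearMap.congr_fun (D.inside E h).quotientCoact_comp_mkQ x
  refine Eq.trans h4 ?_
  have h5 := congrArg ((D.inside E h).toSubmodule.mkQ.lTensor A) h2
  rw [← LinearMap.comp_apply, ← LinearMap.lTensor_comp, h3, map_sub, LinearMap.lTensor_zero,
    LinearMap.zero_apply, sub_eq_zero, LinearMap.lTensor_tmul] at h5
  exact h5

/-- A subcomodule that is not everything extends by one dimension when its quotient has a nonzero
coinvariant element. -/
theorem exists_finrank_eq_succ [FiniteDimensional K C] (D : Subcomodule K A C)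
    (hD : ∃ q : C ⧸ D.toSubmodule, q ≠ 0 ∧ coact (K := K) (A := A) q = (1 : A) ⊗ₜ[K] q) :
    ∃ E : Subcomodule K A C, D.toSubmodule ≤ E.toSubmodule ∧
      Module.finrank K E.toSubmodule = Module.finrank K D.toSubmodule + 1 ∧
      ∀ x ∈ E.toSubmodule, coact (K := K) (A := A) x - (1 : A) ⊗ₜ[K] x ∈
        LinearMap.range (D.toSubmodule.subtype.lTensor A) := by
  obtain ⟨q, hq, hqc⟩ := hD
  let S : Submodule K C := (Submodule.span K {q}).comap D.toSubmodule.mkQ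
  have hDS : D.toSubmodule ≤ S := fun x hx => by
    simp [S, (Submodule.Quotient.mk_eq_zero _).2 hx]
  have hS : ∀ x ∈ S, coact (K := K) (A := A) x - (1 : A) ⊗ₜ[K] x ∈
      LinearMap.range (D.toSubmodule.subtype.lTensor A) := by
    intro x hx
    obtain ⟨a, ha⟩ := Submodule.mem_span_singleton.1 (show D.toSubmodule.mkQ x ∈ _ from hx)
    -- By right exactness, `A ⊗ D` is the kernel of `A ⊗ C → A ⊗ (C ⧸ D)`, and there the defect
    -- vanishes because `x` maps to a multiple of `q`.
    have hex : Function.Exact (D.toSubmodule.subtype.lTensor A) (D.toSubmodule.mkQ.lTensor A) :=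
      lTensor_exact A (LinearMap.exact_subtype_mkQ _) D.toSubmodule.mkQ_surjective
    refine (hex _).1 ?_
    have h := LinearMap.congr_fun D.quotientCoact_comp_mkQ x
    simp only [LinearMap.comp_apply] at h
    rw [map_sub, ← h, ← ha, map_smul]
    rw [show D.quotientCoact q = (1 : A) ⊗ₜ[K] q from hqc, LinearMap.lTensor_tmul, ← ha,
      TensorProduct.tmul_smul, sub_self]
  refine ⟨⟨S, fun x hx => ?_⟩, hDS, ?_, hS⟩
  · obtain ⟨y, hy⟩ := hS x hx
    have h1 : S.subtype ∘ₗ Submodule.inclusion hDS = D.toSubmodule.subtype := rfl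
    refine ⟨(Submodule.inclusion hDS).lTensor A y + (1 : A) ⊗ₜ[K] (⟨x, hx⟩ : S), ?_⟩
    rw [map_add, ← LinearMap.comp_apply, ← LinearMap.lTensor_comp, h1, hy]
    simp
  · have h1 := LinearMap.finrank_range_add_finrank_ker (D.toSubmodule.mkQ.domRestrict S)
    have h2 : LinearMap.ker (D.toSubmodule.mkQ.domRestrict S) = D.toSubmodule.submoduleOf S := by
      rw [LinearMap.ker_domRestrict, Submodule.ker_mkQ]
      rfl
    rw [LinearMap.range_domRestrict,
      Submodule.map_comap_eq_of_surjective D.toSubmodule.mkQ_surjective, finrank_span_singleton hq,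
      h2, (Submodule.submoduleOfEquivOfLe hDS).finrank_eq] at h1
    rw [← h1, add_comm]

/-- The zero subcomodule. -/
def zero : Subcomodule K A C where
  toSubmodule := ⊥
  coact_mem := by
    rintro x hx
    rw [(Submodule.mem_bot K).1 hx, map_zero]
    exact Submodule.zero_mem _

theorem exists_flag [FiniteDimensional K C]
    (hC : ∀ D : Subcomodule K A C, D.toSubmodule ≠ ⊤ →
      ∃ q : C ⧸ D.toSubmodule, q ≠ 0 ∧ coact (K := K) (A := A) q = (1 : A) ⊗ₜ[K] q)
    (n : ℕ) (hn : Module.finrank K C = n) :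
    ∃ F : Fin (n + 1) → Subcomodule K A C,
      (∀ i, Module.finrank K (F i).toSubmodule = (i : ℕ)) ∧
      (F 0).toSubmodule = ⊥ ∧
      (F (Fin.last n)).toSubmodule = ⊤ ∧
      ∃ hF : ∀ i : Fin n, (F i.castSucc).toSubmodule ≤ (F i.succ).toSubmodule,
        ∀ i : Fin n, LeftComodule.IsTrivial K A
          ((F i.succ).toSubmodule ⧸ ((F i.castSucc).inside (F i.succ) (hF i)).toSubmodule) := by
  -- `next` is total, with no control at `D = ⊤`; the iteration meets only proper subcomodules
  -- before step `n`.
  choose! next hle hrank htriv using fun D : Subcomodule K A C => fun hD : D.toSubmodule ≠ ⊤ =>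
    D.exists_finrank_eq_succ (hC D hD)
  let G : ℕ → Subcomodule K A C := fun k => next^[k] zero
  have hG : ∀ k, G (k + 1) = next (G k) := fun k => Function.iterate_succ_apply' _ _ _
  have hr : ∀ k ≤ n, Module.finrank K (G k).toSubmodule = k := by
    intro k
    induction k with
    | zero => intro _; exact finrank_bot K C
    | succ k ih =>
      intro hk
      have hk' := ih (by omega)
      rw [hG, hrank, hk']
      intro h
      rw [h, finrank_top] at hk'
      omega
  have ht : ∀ k < n, (G k).toSubmodule ≠ ⊤ := by
    intro k hk h
    have := hr k hk.le
    rw [h, finrank_top] at this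
    omega
  refine ⟨fun i => G i, fun i => hr i (by omega), rfl,
    Submodule.eq_top_of_finrank_eq ((hr n le_rfl).trans hn.symm), fun i => ?_, fun i => ?_⟩
  · change (G i).toSubmodule ≤ (G (i + 1)).toSubmodule
    rw [hG]
    exact hle _ (ht i i.2)
  · refine isTrivial_quotient_inside _ ?_
    change ∀ x ∈ (G (i + 1)).toSubmodule, _ - _ ∈
      LinearMap.range ((G i).toSubmodule.subtype.lTensor A)
    rw [hG]
    exact htriv _ (ht i i.2)

end

end Subcomodule

/-! ### Rescaling of polynomials according to a weight -/

namespace MvPolynomial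

variable {σ R : Type*} [CommSemiring R]

/-- The endomorphism multiplying the variable `i` by `a ^ w i`. -/
noncomputable def weightScale (w : σ → ℕ) (a : R) : MvPolynomial σ R →ₐ[R] MvPolynomial σ R :=
  aeval fun i => a ^ w i • X i

theorem weightScale_X (w : σ → ℕ) (a : R) (i : σ) : weightScale w a (X i) = a ^ w i • X i :=
  aeval_X _ _

theorem weightScale_monomial (w : σ → ℕ) (a : R) (d : σ →₀ ℕ) (r : R) :
    weightScale w a (monomial d r) = a ^ Finsupp.weight w d • monomial d r := by
  rw [weightScale, aeval_monomial, monomial_eq, Finsupp.weight_apply, ← algebraMap_eq,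
    ← mul_smul_comm]
  congr 1
  simp only [Finsupp.prod, Finsupp.sum, smul_pow, smul_eq_mul, ← pow_mul, Finset.prod_smul,
    Finset.prod_pow_eq_pow_sum, mul_comm (w _)]

theorem coeff_weightScale (w : σ → ℕ) (a : R) (d : σ →₀ ℕ) (p : MvPolynomial σ R) :
    coeff d (weightScale w a p) = a ^ Finsupp.weight w d * coeff d p := by
  classical
  induction p using MvPolynomial.induction_on' with
  | monomial e r =>
    rw [weightScale_monomial, coeff_smul, smul_eq_mul, coeff_monomial]
    split_ifs with h
    · rw [h]
    · simp
  | add p q hp hq => rw [map_add, coeff_add, hp, hq, coeff_add, mul_add]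

theorem weightScale_weightedHomogeneousComponent (w : σ → ℕ) (a : R) (n : ℕ)
    (p : MvPolynomial σ R) :
    weightScale w a (weightedHomogeneousComponent w n p) =
      a ^ n • weightedHomogeneousComponent w n p := by
  ext d
  rw [coeff_weightScale, coeff_smul, smul_eq_mul, coeff_weightedHomogeneousComponent]
  split_ifs with h
  · rw [h]
  · simp

theorem weightedHomogeneousComponent_weightScale (w : σ → ℕ) (a : R) (n : ℕ)
    (p : MvPolynomial σ R) :
    weightedHomogeneousComponent w n (weightScale w a p) =
      a ^ n • weightedHomogeneousComponent w n p := by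
  ext d
  rw [coeff_smul, smul_eq_mul, coeff_weightedHomogeneousComponent,
    coeff_weightedHomogeneousComponent, coeff_weightScale]
  split_ifs with h
  · rw [h]
  · simp

/-- No monomial of `p` has weight above the weighted total degree, so the components of index below
`M` exhaust `p`. -/
theorem sum_range_weightedHomogeneousComponent (w : σ → ℕ) (p : MvPolynomial σ R) {M : ℕ}
    (hM : weightedTotalDegree w p < M) :
    ∑ k ∈ Finset.range M, weightedHomogeneousComponent w k p = p := by
  ext d
  simp only [coeff_sum, coeff_weightedHomogeneousComponent, Finset.sum_ite_eq, Finset.mem_range]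
  split_ifs with h
  · rfl
  · by_contra hd
    exact h ((le_weightedTotalDegree w (mem_support_iff.2 (Ne.symm hd))).trans_lt hM)

end MvPolynomial

/-! ### The grading of the Hopf algebra of rooted trees -/

namespace ConnesKreimer

open MvPolynomial

/-- The number of vertices of a rooted tree. -/
noncomputable def TreeClass.card : TreeClass → ℕ :=
  Quotient.lift (fun t : FinTree => Nat.card t.tree)
    fun _ _ h => Nonempty.elim h fun e => Nat.card_congr e.toEquiv

/-- This is what makes the grading connected: only constants have degree 0. -/
theorem TreeClass.card_ne_zero (q : TreeClass) : q.card ≠ 0 := by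
  induction q using Quotient.inductionOn with
  | h t => exact (Nat.card_pos (α := t.tree)).ne'

/-- A cut partitions the vertices. The trunk is the complement of the up-sets of the cut vertices,
and these are disjoint: two vertices below a common one are comparable in a tree, which the
antichain condition forbids. -/
theorem AdmissibleCut.sum_card_above_add_card_trunk {t : FinTree} (c : AdmissibleCut t) :
    ∑ v ∈ c.cut, Nat.card (t.above v).tree + Nat.card c.trunk.tree = Nat.card t.tree := by
  classical
  have h : (⋃ v ∈ c.cut, Set.Ici v) = c.trunkSetᶜ := by
    ext x
    simp [trunkSet]
  have h1 : (⋃ v ∈ c.cut, Set.Ici v).ncard = ∑ v ∈ c.cut, (Set.Ici v).ncard := by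
    rw [← finsum_mem_coe_finset]
    refine Set.Finite.ncard_biUnion c.cut.finite_toSet (fun _ _ => Set.toFinite _) ?_
    intro v hv w hw hvw
    refine Set.disjoint_left.2 fun x hx hx' => ?_
    rcases le_total_of_directed hx hx' with hle | hle
    · exact c.antichain hw hv hvw.symm hle
    · exact c.antichain hv hw hvw hle
  have h2 := Set.ncard_add_ncard_compl c.trunkSet
  rw [← h, h1, add_comm] at h2
  exact h2

/-- The algebra endomorphism multiplying each tree `t` by `2 ^ |t|`. -/
noncomputable def scaleHom : HR →ₐ[ℚ] HR :=
  (weightScale TreeClass.card (2 : ℚ) : MvPolynomial TreeClass ℚ →ₐ[ℚ] MvPolynomial TreeClass ℚ)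

/-- The projection of `HR` onto its homogeneous component of degree `k`. -/
noncomputable def component (k : ℕ) : HR →ₗ[ℚ] HR :=
  (weightedHomogeneousComponent TreeClass.card k :
    MvPolynomial TreeClass ℚ →ₗ[ℚ] MvPolynomial TreeClass ℚ)

theorem scaleHom_gen (t : FinTree) : scaleHom t.gen = (2 : ℚ) ^ Nat.card t.tree • t.gen :=
  weightScale_X _ _ _

theorem algHom_ext {B : Type*} [Semiring B] [Algebra ℚ B] {f g : HR →ₐ[ℚ] B}
    (h : ∀ t : FinTree, f t.gen = g t.gen) : f = g :=
  MvPolynomial.algHom_ext (A := B) fun q => Quotient.inductionOn q h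

theorem AdmissibleCut.scaleHom_pruned {t : FinTree} (c : AdmissibleCut t) :
    scaleHom c.pruned = (2 : ℚ) ^ (∑ v ∈ c.cut, Nat.card (t.above v).tree) • c.pruned := by
  rw [pruned, map_prod, ← Finset.prod_pow_eq_pow_sum, Finset.prod_congr rfl
    fun v _ => scaleHom_gen _, Finset.prod_smul]

/-- Both sides are algebra morphisms, so generators suffice; there every term of the coproduct
scales by `2 ^ |t|`, since a cut preserves the number of vertices. -/
theorem comulHom_comp_scaleHom :
    comulHom.comp scaleHom = (Algebra.TensorProduct.map scaleHom scaleHom).comp comulHom := by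
  refine algHom_ext fun t => ?_
  rw [AlgHom.comp_apply, AlgHom.comp_apply, scaleHom_gen, map_smul, comulHom_gen, FinTree.coproduct,
    map_add, map_add, map_sum]
  rw [smul_add, smul_add, Finset.smul_sum]
  congr 1
  · simp [scaleHom_gen, TensorProduct.smul_tmul']
  · refine Finset.sum_congr rfl fun c _ => ?_
    rw [Algebra.TensorProduct.map_tmul, scaleHom_gen, c.scaleHom_pruned,
      TensorProduct.smul_tmul_smul, ← pow_add, c.sum_card_above_add_card_trunk]

theorem exists_sum_component_eq (a : HR) :
    ∃ N, ∀ M ≥ N, ∑ k ∈ Finset.range M, component k a = a :=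
  ⟨weightedTotalDegree TreeClass.card (a : MvPolynomial TreeClass ℚ) + 1, fun _ hM =>
    sum_range_weightedHomogeneousComponent TreeClass.card (a : MvPolynomial TreeClass ℚ) hM⟩

theorem component_zero (a : HR) :
    component 0 a = algebraMap ℚ HR (CoalgebraStruct.counit (R := ℚ) a) := by
  refine (weightedHomogeneousComponent_zero (a : MvPolynomial TreeClass ℚ)
    TreeClass.card_ne_zero).trans ?_
  refine congrArg (C : ℚ →+* MvPolynomial TreeClass ℚ) ?_
  exact (aeval_zero' (S₁ := ℚ) (a : MvPolynomial TreeClass ℚ)).symm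

theorem map_component_comul_component {i j m : ℕ} (h : m ≠ i + j) (a : HR) :
    TensorProduct.map (component i) (component j)
      (CoalgebraStruct.comul (R := ℚ) (component m a)) = 0 := by
  have h1 : scaleHom (component m a) = (2 : ℚ) ^ m • component m a :=
    weightScale_weightedHomogeneousComponent _ _ _ _
  have h2 : ∀ k, component k ∘ₗ scaleHom.toLinearMap = (2 : ℚ) ^ k • component k := fun k =>
    LinearMap.ext fun b => weightedHomogeneousComponent_weightScale _ _ _ _
  have h3 := congrArg (TensorProduct.map (component i) (component j))
    (DFunLike.congr_fun comulHom_comp_scaleHom (component m a))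
  rw [AlgHom.comp_apply, AlgHom.comp_apply, h1, map_smul, map_smul] at h3
  have h4 : ∀ z : HR ⊗[ℚ] HR, TensorProduct.map (component i) (component j)
      (Algebra.TensorProduct.map scaleHom scaleHom z) =
      (2 : ℚ) ^ (i + j) • TensorProduct.map (component i) (component j) z := by
    intro z
    change TensorProduct.map (component i) (component j)
      (TensorProduct.map scaleHom.toLinearMap scaleHom.toLinearMap z) = _
    rw [← LinearMap.comp_apply, ← TensorProduct.map_comp, h2, h2, TensorProduct.map_smul_left,
      TensorProduct.map_smul_right, smul_smul, ← pow_add, LinearMap.smul_apply]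
  rw [h4] at h3
  change TensorProduct.map (component i) (component j) (comulHom (component m a)) = 0
  by_contra hne
  -- A nonzero value would be scaled both by `2 ^ m` and by `2 ^ (i + j)`, forcing `m = i + j`.
  exact h (pow_right_injective₀ (by norm_num) (by norm_num) (smul_left_injective ℚ hne h3))

end ConnesKreimer

theorem mainTheorem9 (C : Type*) [AddCommGroup C] [Module ℚ C]
    [LeftComodule ℚ ConnesKreimer.HR C] [FiniteDimensional ℚ C]
    (n : ℕ) (hn : Module.finrank ℚ C = n) :
    ∃ F : Fin (n + 1) → Subcomodule ℚ ConnesKreimer.HR C,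
      (∀ i, Module.finrank ℚ (F i).toSubmodule = (i : ℕ)) ∧
      (F 0).toSubmodule = ⊥ ∧
      (F (Fin.last n)).toSubmodule = ⊤ ∧
      ∃ hF : ∀ i : Fin n, (F i.castSucc).toSubmodule ≤ (F i.succ).toSubmodule,
        ∀ i : Fin n, LeftComodule.IsTrivial ℚ ConnesKreimer.HR
          ((F i.succ).toSubmodule ⧸ ((F i.castSucc).inside (F i.succ) (hF i)).toSubmodule) := by
  refine Subcomodule.exists_flag (fun D hD => ?_) n hn
  have := Submodule.Quotient.nontrivial_iff.2 hD
  exact exists_ne_zero_coact_eq_one_tmul ConnesKreimer.exists_sum_component_eq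
    ConnesKreimer.component_zero fun i j m h => ConnesKreimer.map_component_comul_component h
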